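/- Let $1\le k_0<n_0$ be integers, $m_0=n_0-k_0$, and write $n_0\times n_0$ complex matrices in blocks of sizes $k_0,m_0$. Let $G=G_{n_0,k_0}$ be the complex Grassmannian, realised as the set of Hermitian matrices $A$ with $A^2=A$ and $\operatorname{rank}A=k_0$, with origin $A_0=\begin{pmatrix}I_{k_0}&0\\0&0\end{pmatrix}$. At $A=BA_0B^*$ with $B\in U(n_0)$, the tangent space $T_AG$ consists of the matrices $B\begin{pmatrix}0&V\\V^*&0\end{pmatrix}B^*$, $V\in\mathbb C^{k_0\times m_0}$; the complex structure $J_A$ replaces $V$ by $\sqrt{-1}\,V$, and the Riemannian metric is $h_A=\operatorname{Re}\operatorname{tr}(VW^*)$ for the tangent vectors given by $V$ and $W$. Let $\nabla_x$ be the covariant derivative along maps into $G$ induced by the Levi-Civita connection of $h$. Let $0<T\le\infty$ and let $u:(-T,T)\times\mathbb R\to G$ be a smooth map such that, for every $t\in(-T,T)$, $\lim_{x\to-\infty}u(t,x)=A_0$ and $u_x(t,\cdot)$ is in the Schwartz class. Put $\sigma_3=\frac{\sqrt{-1}}{2}\begin{pmatrix}I_{k_0}&0\\0&-I_{m_0}\end{pmatrix}$,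 let $\Psi(BA_0B^*)=B\sigma_3B^*$ for $B\in U(n_0)$ (an identification of $G$ with the adjoint orbit of $\sigma_3$), and let $\mathfrak m_I=\left\{\begin{pmatrix}0&\omega\\-\omega^*&0\end{pmatrix}:\omega\in\mathbb C^{k_0\times m_0}\right\}$. Then: (1) There is a unique map $E:(-T,T)\times\mathbb R\to U(n_0)$, smooth in $x$, with $\Psi(u)=E^{-1}\sigma_3E$, $\lim_{x\to-\infty}E(t,x)=I$ for every $t$, and $P:=E_xE^{-1}$ taking values in $\mathfrak m_I$. (2) There are unique tangent vector fields $e_j$ along $u$, smooth in $x$, indexed by $j=(j_1,j_2)$ with $1\le j_1\le k_0$, $1\le j_2\le m_0$, such that $\nabla_xe_j=0$ and, for every $t$, $\lim_{x\to-\infty}e_j(t,x)=\begin{pmatrix}0&E_{(j_1,j_2)}\\E_{(j_1,j_2)}^*&0\end{pmatrix}$, where $E_{(j_1,j_2)}\in\mathbb C^{k_0\times m_0}$ has the entry $1$ at position $(j_1,j_2)$ and $0$ elsewhere. Moreover $\{e_j,J_ue_j\}_j$ is orthonormal at every point. (3) Let $Q_j=h(u_x,e_j)+\sqrt{-1}\,h(u_x,J_ue_j)$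 for $j=(j_1,j_2)$, and let $(Q_{(j_1,j_2)})$ be the $k_0\times m_0$ matrix function with these entries. Then on $(-T,T)\times\mathbb R$ $$P=\begin{pmatrix}0&(Q_{(j_1,j_2)})\\-(Q_{(j_1,j_2)})^*&0\end{pmatrix}.$$ -/

import Mathlib

open scoped ContDiff Matrix

noncomputable section

namespace GrassmannFlow

/-- Square complex matrices of size `k + m`, written in blocks of sizes `k` and `m`. -/
abbrev Mat (k m : ℕ) := Matrix (Fin k ⊕ Fin m) (Fin k ⊕ Fin m) ℂ

section Grassmannian

variable {k m : ℕ}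

/-- The complex Grassmannian of `k`-planes in `ℂ^(k+m)`: Hermitian projectors of rank `k`. -/
def grassmannian (k m : ℕ) : Set (Mat k m) :=
  {A | A.IsHermitian ∧ A * A = A ∧ A.rank = k}

/-- The origin `A₀ = diag(I_k, 0)` of the Grassmannian. -/
def origin (k m : ℕ) : Mat k m := Matrix.fromBlocks 1 0 0 0

/-- The Hermitian matrix with off-diagonal blocks `V` and `V*`. -/
def hermBlock (V : Matrix (Fin k) (Fin m) ℂ) : Mat k m := Matrix.fromBlocks 0 V Vᴴ 0

/-- The skew-Hermitian matrix with off-diagonal blocks `V` and `-V*`. -/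
def skewBlock (V : Matrix (Fin k) (Fin m) ℂ) : Mat k m := Matrix.fromBlocks 0 V (-Vᴴ) 0

/-- The subspace `𝔪_I` of the Lie algebra of skew-Hermitian matrices. -/
def mI (k m : ℕ) : Set (Mat k m) := {P | ∃ V : Matrix (Fin k) (Fin m) ℂ, P = skewBlock V}

/-- The tangent space of the Grassmannian at `A`: the Hermitian `H` with `H A + A H = H`;
see `mem_tangentSpace_iff` for the description by blocks. -/
def tangentSpace (A : Mat k m) : Set (Mat k m) := {H | H.IsHermitian ∧ H * A + A * H = H}

/-- The complex structure `J_A`, see `complexStructure_conj` for the description by blocks. -/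
def complexStructure (A X : Mat k m) : Mat k m := Complex.I • (A * X - X * A)

/-- The Riemannian metric `h`, see `metric_conj` for the description by blocks. -/
def metric (X Y : Mat k m) : ℝ := (1 / 2) * (Matrix.trace (X * Yᴴ)).re

/-- `σ₃ = (√-1 / 2) diag(I_k, -I_m)`. -/
def sigma3 (k m : ℕ) : Mat k m := (Complex.I / 2) • Matrix.fromBlocks 1 0 0 (-1)

/-- The identification `Ψ` of the Grassmannian with the adjoint orbit of `σ₃`,
`Ψ(B A₀ B*) = B σ₃ B*`; see `psi_conj`. -/
def psi (A : Mat k m) : Mat k m := Complex.I • (A - (1 / 2 : ℂ) • (1 : Mat k m))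

/-- The orthogonal projection of the space of Hermitian matrices onto the tangent space at `A`;
see `tangentProj_mem`, `tangentProj_of_mem` and `metric_sub_tangentProj`. -/
def tangentProj (A X : Mat k m) : Mat k m := A * X * (1 - A) + (1 - A) * X * A

/-- The derivative of a curve of matrices, entry by entry. -/
def matDeriv (F : ℝ → Mat k m) (x : ℝ) : Mat k m :=
  Matrix.of fun i j => deriv (fun y => F y i j) x

/-- Smoothness of a curve of matrices. -/
def SmoothCurve (F : ℝ → Mat k m) : Prop := ∀ i j, ContDiff ℝ ∞ fun x => F x i j

/-- The covariant derivative `∇ₓ V` of a vector field `V` along a curve `γ` in the Grassmannian, for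
the Levi-Civita connection of `metric`.  As `metric` is induced by the (constant) real inner product
`(1/2) Re tr (X Y*)` of the surrounding space of Hermitian matrices, this is the orthogonal projection
of the derivative `V'` onto the tangent space.  It is metric and torsion free:
see `hasDerivAt_metric` and `covDeriv_symm`. -/
def covDeriv (γ V : ℝ → Mat k m) (x : ℝ) : Mat k m := tangentProj (γ x) (matDeriv V x)

end Grassmannian

/-- The time interval `(-T, T)`, where `T = ∞` is allowed. -/
def timeInterval (T : EReal) : Set ℝ := {t | -T < (t : EReal) ∧ (t : EReal) < T}

section Maps

variable {k m : ℕ}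

/-- The class of smooth maps `u : (-T, T) × ℝ → G` with `u(t, x) → a` as `x → -∞` and with
`u_x(t, ·)` in the Schwartz class, for every `t ∈ (-T, T)`. -/
structure MemC (T : EReal) (a : Mat k m) (u : ℝ → ℝ → Mat k m) : Prop where
  smooth : ∀ i j, ContDiffOn ℝ ∞ (fun p : ℝ × ℝ => u p.1 p.2 i j) (timeInterval T ×ˢ Set.univ)
  mem : ∀ t ∈ timeInterval T, ∀ x, u t x ∈ grassmannian k m
  lim : ∀ t ∈ timeInterval T, Filter.Tendsto (u t) Filter.atBot (nhds a)
  schwartz : ∀ t ∈ timeInterval T, ∀ i j,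
    ∃ f : SchwartzMap ℝ ℂ, ∀ x, f x = matDeriv (u t) x i j

/-- `P = E_x E⁻¹ = E_x E*` for a unitary matrix function `E`. -/
def logDeriv {T : EReal} (E : timeInterval T → ℝ → Mat k m) (t : timeInterval T) (x : ℝ) :
    Mat k m :=
  matDeriv (E t) x * (E t x)ᴴ

/-- The frame `E : (-T, T) × ℝ → U(k + m)` with `Ψ(u) = E⁻¹ σ₃ E`, `E(t, -∞) = I`, and
`E_x E⁻¹` taking values in `𝔪_I`. -/
structure IsOrbitFrame {T : EReal} (u : ℝ → ℝ → Mat k m) (E : timeInterval T → ℝ → Mat k m) :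
    Prop where
  smooth : ∀ t : timeInterval T, SmoothCurve (E t)
  unitary : ∀ (t : timeInterval T) (x : ℝ), E t x ∈ Matrix.unitaryGroup (Fin k ⊕ Fin m) ℂ
  orbit : ∀ (t : timeInterval T) (x : ℝ), psi (u t x) = (E t x)ᴴ * sigma3 k m * E t x
  lim : ∀ t : timeInterval T, Filter.Tendsto (E t) Filter.atBot (nhds 1)
  logDeriv_mem : ∀ (t : timeInterval T) (x : ℝ), logDeriv E t x ∈ mI k m

/-- The parallel frame `e_j`, `j = (j₁, j₂)`, along `u`: each `e_j(t, ·)` is a smooth tangent vector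
field along `u(t, ·)` with `∇ₓ e_j = 0`, and it tends to the matrix with off-diagonal blocks
`E_(j₁,j₂)` and `E_(j₁,j₂)*` as `x → -∞`, where `E_(j₁,j₂)` has the entry `1` at `(j₁, j₂)` and `0`
elsewhere. -/
structure IsParallelFrame {T : EReal} (u : ℝ → ℝ → Mat k m)
    (e : timeInterval T → Fin k × Fin m → ℝ → Mat k m) : Prop where
  smooth : ∀ (t : timeInterval T) (j : Fin k × Fin m), SmoothCurve (e t j)
  tangent : ∀ (t : timeInterval T) (j : Fin k × Fin m) (x : ℝ), e t j x ∈ tangentSpace (u t x)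
  parallel : ∀ (t : timeInterval T) (j : Fin k × Fin m) (x : ℝ), covDeriv (u t) (e t j) x = 0
  lim : ∀ (t : timeInterval T) (j : Fin k × Fin m), Filter.Tendsto (e t j) Filter.atBot
    (nhds (hermBlock (Matrix.single j.1 j.2 1)))

/-- `{e_j, J_u e_j}` is orthonormal at every point. -/
def IsOrthonormalFrame {T : EReal} (u : ℝ → ℝ → Mat k m)
    (e : timeInterval T → Fin k × Fin m → ℝ → Mat k m) : Prop :=
  ∀ (t : timeInterval T) (x : ℝ) (j l : Fin k × Fin m),
    metric (e t j x) (e t l x) = (if j = l then 1 else 0) ∧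
    metric (complexStructure (u t x) (e t j x)) (complexStructure (u t x) (e t l x))
      = (if j = l then 1 else 0) ∧
    metric (e t j x) (complexStructure (u t x) (e t l x)) = 0

/-- The components `Q_j = h(u_x, e_j) + √-1 h(u_x, J_u e_j)`, `j = (j₁, j₂)`, arranged in a matrix. -/
def components {T : EReal} (u : ℝ → ℝ → Mat k m)
    (e : timeInterval T → Fin k × Fin m → ℝ → Mat k m) (t : timeInterval T) (x : ℝ) :
    Matrix (Fin k) (Fin m) ℂ :=
  Matrix.of fun j₁ j₂ =>
    (metric (matDeriv (u t) x) (e t (j₁, j₂) x) : ℂ) +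
      Complex.I * (metric (matDeriv (u t) x) (complexStructure (u t x) (e t (j₁, j₂) x)) : ℂ)

end Maps

section Facts

variable {k m : ℕ}

theorem psi_conj {B : Mat k m} (hB : B ∈ Matrix.unitaryGroup (Fin k ⊕ Fin m) ℂ) :
    psi (B * origin k m * Bᴴ) = B * sigma3 k m * Bᴴ := by
  have h1 : B * Bᴴ = 1 := Matrix.mem_unitaryGroup_iff.1 hB
  have h2 : sigma3 k m = Complex.I • (origin k m - (1 / 2 : ℂ) • (1 : Mat k m)) := by
    rw [sigma3, origin, ← Matrix.fromBlocks_one, Matrix.fromBlocks_smul, Matrix.fromBlocks_smul,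
      sub_eq_add_neg, Matrix.fromBlocks_neg, Matrix.fromBlocks_add, Matrix.fromBlocks_smul]
    congr 1
    · ext i j
      by_cases h : i = j <;> simp [h]; ring
    · simp
    · simp
    · ext i j
      by_cases h : i = j <;> simp [h]; ring
  rw [h2, psi]
  simp only [Matrix.mul_smul, Matrix.smul_mul, mul_sub, sub_mul, mul_one, h1]

theorem mem_tangentSpace_iff {B : Mat k m} (hB : B ∈ Matrix.unitaryGroup (Fin k ⊕ Fin m) ℂ)
    (H : Mat k m) :
    H ∈ tangentSpace (B * origin k m * Bᴴ) ↔
      ∃ V : Matrix (Fin k) (Fin m) ℂ, H = B * hermBlock V * Bᴴ := by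
  have h1 : B * Bᴴ = 1 := Matrix.mem_unitaryGroup_iff.1 hB
  have h2 : Bᴴ * B = 1 := Matrix.mem_unitaryGroup_iff'.1 hB
  constructor
  · rintro ⟨hH, hT⟩
    set K : Mat k m := Bᴴ * H * B with hK
    have hHK : H = B * K * Bᴴ := by
      calc H = (B * Bᴴ) * H * (B * Bᴴ) := by rw [h1]; simp
        _ = B * K * Bᴴ := by rw [hK]; simp only [Matrix.mul_assoc]
    have hKh : Kᴴ = K := by
      rw [hK]; simp [Matrix.conjTranspose_mul, hH.eq, Matrix.mul_assoc]
    have hKT : K * origin k m + origin k m * K = K := by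
      have := congrArg (fun X => Bᴴ * X * B) hT
      calc K * origin k m + origin k m * K
          = Bᴴ * H * B * origin k m * (Bᴴ * B) + (Bᴴ * B) * origin k m * (Bᴴ * H * B) := by
            rw [h2, hK]; simp
        _ = Bᴴ * (H * (B * origin k m * Bᴴ) + B * origin k m * Bᴴ * H) * B := by
            simp only [Matrix.mul_assoc, Matrix.mul_add, Matrix.add_mul]
        _ = K := by rw [hT]
    clear_value K
    refine ⟨K.toBlocks₁₂, ?_⟩
    rw [hHK]
    congr 2
    have hb := Matrix.fromBlocks_toBlocks K
    rw [← hb] at hKT hKh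
    rw [origin, Matrix.fromBlocks_multiply, Matrix.fromBlocks_multiply,
      Matrix.fromBlocks_add] at hKT
    rw [Matrix.fromBlocks_conjTranspose] at hKh
    obtain ⟨a1, a2, a3, a4⟩ := Matrix.fromBlocks_inj.1 hKT
    obtain ⟨b1, b2, b3, b4⟩ := Matrix.fromBlocks_inj.1 hKh
    rw [hermBlock, b3]
    conv_lhs => rw [← hb]
    congr 1
    · simpa using a1
    · simpa using a4.symm
  · rintro ⟨V, rfl⟩
    refine ⟨?_, ?_⟩
    · simp [Matrix.IsHermitian, hermBlock, Matrix.conjTranspose_mul, Matrix.fromBlocks_conjTranspose,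
        Matrix.mul_assoc]
    · have : hermBlock V * origin k m + origin k m * hermBlock V = hermBlock V := by
        simp [hermBlock, origin, Matrix.fromBlocks_multiply, Matrix.fromBlocks_add]
      calc B * hermBlock V * Bᴴ * (B * origin k m * Bᴴ)
            + B * origin k m * Bᴴ * (B * hermBlock V * Bᴴ)
          = B * hermBlock V * (Bᴴ * B) * origin k m * Bᴴ
            + B * origin k m * (Bᴴ * B) * hermBlock V * Bᴴ := by simp only [Matrix.mul_assoc]
        _ = B * (hermBlock V * origin k m + origin k m * hermBlock V) * Bᴴ := by
            rw [h2]; simp only [Matrix.mul_one, Matrix.mul_assoc, Matrix.mul_add, Matrix.add_mul]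
        _ = _ := by rw [this]

theorem metric_conj {B : Mat k m} (hB : B ∈ Matrix.unitaryGroup (Fin k ⊕ Fin m) ℂ)
    (V W : Matrix (Fin k) (Fin m) ℂ) :
    metric (B * hermBlock V * Bᴴ) (B * hermBlock W * Bᴴ) = (Matrix.trace (V * Wᴴ)).re := by
  have h2 : Bᴴ * B = 1 := Matrix.mem_unitaryGroup_iff'.1 hB
  have h3 : B * hermBlock V * Bᴴ * (B * hermBlock W * Bᴴ)ᴴ
      = B * (hermBlock V * (hermBlock W)ᴴ * Bᴴ) := by
    calc _ = B * hermBlock V * (Bᴴ * B) * (hermBlock W)ᴴ * Bᴴ := by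
          simp [Matrix.conjTranspose_mul, Matrix.mul_assoc]
      _ = _ := by rw [h2]; simp [Matrix.mul_assoc]
  have h4 : (Matrix.trace (Vᴴ * W)).re = (Matrix.trace (V * Wᴴ)).re := by
    rw [Matrix.trace_mul_comm, ← Complex.conj_re (Matrix.trace (V * Wᴴ)), starRingEnd_apply,
      ← Matrix.trace_conjTranspose]
    simp [Matrix.conjTranspose_mul]
  rw [metric, h3, Matrix.trace_mul_comm, Matrix.mul_assoc, h2, Matrix.mul_one]
  simp only [hermBlock, Matrix.fromBlocks_conjTranspose, Matrix.fromBlocks_multiply,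
    Matrix.trace, Fintype.sum_sum_type, Matrix.diag_apply, Matrix.fromBlocks_apply₁₁,
    Matrix.fromBlocks_apply₂₂, Matrix.conjTranspose_zero, Matrix.conjTranspose_conjTranspose,
    Matrix.zero_mul, Matrix.mul_zero, zero_add, add_zero, Complex.add_re]
  simp only [Matrix.trace, Matrix.diag_apply] at h4
  rw [h4]; ring

theorem complexStructure_conj {B : Mat k m} (hB : B ∈ Matrix.unitaryGroup (Fin k ⊕ Fin m) ℂ)
    (V : Matrix (Fin k) (Fin m) ℂ) :
    complexStructure (B * origin k m * Bᴴ) (B * hermBlock V * Bᴴ)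
      = B * hermBlock (Complex.I • V) * Bᴴ := by
  have h2 : Bᴴ * B = 1 := Matrix.mem_unitaryGroup_iff'.1 hB
  have h3 : hermBlock (Complex.I • V)
      = Complex.I • (origin k m * hermBlock V - hermBlock V * origin k m) := by
    simp [hermBlock, origin, Matrix.fromBlocks_multiply, sub_eq_add_neg, Matrix.fromBlocks_neg,
      Matrix.fromBlocks_add, Matrix.fromBlocks_smul, Matrix.conjTranspose_smul]
  have h4 : B * origin k m * Bᴴ * (B * hermBlock V * Bᴴ)
      = B * (origin k m * hermBlock V) * Bᴴ := by
    calc _ = B * origin k m * (Bᴴ * B) * hermBlock V * Bᴴ := by simp only [Matrix.mul_assoc]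
      _ = _ := by rw [h2]; simp only [Matrix.mul_one, Matrix.mul_assoc]
  have h5 : B * hermBlock V * Bᴴ * (B * origin k m * Bᴴ)
      = B * (hermBlock V * origin k m) * Bᴴ := by
    calc _ = B * hermBlock V * (Bᴴ * B) * origin k m * Bᴴ := by simp only [Matrix.mul_assoc]
      _ = _ := by rw [h2]; simp only [Matrix.mul_one, Matrix.mul_assoc]
  rw [complexStructure, h3, h4, h5]
  simp only [Matrix.mul_smul, Matrix.smul_mul, mul_sub, sub_mul]

theorem tangentProj_mem {A X : Mat k m} (hA : A ∈ grassmannian k m) (hX : X.IsHermitian) :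
    tangentProj A X ∈ tangentSpace A := by
  obtain ⟨h1, h2, -⟩ := hA
  refine ⟨?_, ?_⟩
  · rw [Matrix.IsHermitian, tangentProj]
    simp only [Matrix.conjTranspose_add, Matrix.conjTranspose_mul, Matrix.conjTranspose_sub,
      Matrix.conjTranspose_one, h1.eq, hX.eq]
    rw [add_comm]; simp only [Matrix.mul_assoc]
  · have h3 : (1 - A) * A = 0 := by rw [sub_mul, h2, one_mul, sub_self]
    have h4 : A * (1 - A) = 0 := by rw [mul_sub, h2, mul_one, sub_self]
    rw [tangentProj]
    calc _ = A * X * ((1 - A) * A) + (1 - A) * X * (A * A) + (A * A) * X * (1 - A)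
          + (A * (1 - A)) * X * A := by noncomm_ring
      _ = _ := by rw [h3, h4, h2]; simp [add_comm]

theorem tangentProj_of_mem {A X : Mat k m} (hA : A ∈ grassmannian k m) (hX : X ∈ tangentSpace A) :
    tangentProj A X = X := by
  obtain ⟨-, h2, -⟩ := hA
  obtain ⟨-, h⟩ := hX
  have h3 : A * X * A = 0 := by
    have h4 : A * (X * A + A * X) = A * X := by rw [h]
    rw [mul_add, ← mul_assoc, ← mul_assoc, h2] at h4
    simpa using h4
  calc tangentProj A X = (X * A + A * X) - (A * X * A + A * X * A) := by
        rw [tangentProj]; noncomm_ring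
    _ = X := by rw [h, h3]; simp

theorem metric_sub_tangentProj {A X Z : Mat k m} (hA : A ∈ grassmannian k m)
    (hZ : Z ∈ tangentSpace A) : metric (X - tangentProj A X) Z = 0 := by
  obtain ⟨-, h2, -⟩ := hA
  obtain ⟨hZh, h⟩ := hZ
  have h3 : A * Z * A = 0 := by
    have h4 : A * (Z * A + A * Z) = A * Z := by rw [h]
    rw [mul_add, ← mul_assoc, ← mul_assoc, h2] at h4
    simpa using h4
  have h5 : (1 - A) * Z * (1 - A) = 0 := by
    calc (1 - A) * Z * (1 - A) = Z - (Z * A + A * Z) + A * Z * A := by noncomm_ring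
      _ = 0 := by rw [h, h3]; simp
  have h6 : X - tangentProj A X = A * X * A + (1 - A) * X * (1 - A) := by
    rw [tangentProj]; noncomm_ring
  rw [metric, h6, hZh.eq, add_mul, Matrix.trace_add]
  have h7 : Matrix.trace (A * X * A * Z) = 0 := by
    rw [Matrix.mul_assoc, Matrix.mul_assoc, Matrix.trace_mul_comm]
    rw [show X * (A * Z) * A = X * (A * Z * A) by simp only [Matrix.mul_assoc], h3]
    simp
  have h8 : Matrix.trace ((1 - A) * X * (1 - A) * Z) = 0 := by
    rw [Matrix.mul_assoc, Matrix.mul_assoc, Matrix.trace_mul_comm]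
    rw [show X * ((1 - A) * Z) * (1 - A) = X * ((1 - A) * Z * (1 - A)) by
      simp only [Matrix.mul_assoc], h5]
    simp
  rw [h7, h8]; simp

theorem hasDerivAt_metric {γ V W : ℝ → Mat k m} {x : ℝ} (hγ : γ x ∈ grassmannian k m)
    (hV : ∀ y, V y ∈ tangentSpace (γ y)) (hW : ∀ y, W y ∈ tangentSpace (γ y))
    (hV' : ∀ i j, DifferentiableAt ℝ (fun y => V y i j) x)
    (hW' : ∀ i j, DifferentiableAt ℝ (fun y => W y i j) x) :
    HasDerivAt (fun y => metric (V y) (W y))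
      (metric (covDeriv γ V x) (W x) + metric (V x) (covDeriv γ W x)) x := by
  have hsymm : ∀ X Y : Mat k m, metric X Y = metric Y X := by
    intro X Y
    rw [metric, metric, ← Complex.conj_re (Matrix.trace (X * Yᴴ)), starRingEnd_apply,
      ← Matrix.trace_conjTranspose]
    simp [Matrix.conjTranspose_mul]
  have hlin : ∀ X Y Z : Mat k m, metric (X - Y) Z = metric X Z - metric Y Z := by
    intro X Y Z
    simp [metric, sub_mul, mul_sub]
  have e1 : metric (covDeriv γ V x) (W x) = metric (matDeriv V x) (W x) := by
    have := metric_sub_tangentProj (X := matDeriv V x) hγ (hW x)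
    rw [hlin] at this
    rw [covDeriv]; linarith
  have e2 : metric (V x) (covDeriv γ W x) = metric (V x) (matDeriv W x) := by
    have := metric_sub_tangentProj (X := matDeriv W x) hγ (hV x)
    rw [hlin] at this
    rw [covDeriv, hsymm, hsymm (V x)]; linarith
  rw [e1, e2]
  have hexp : ∀ X Y : Mat k m, metric X Y
      = (1 / 2) * (∑ i, ∑ j, X i j * (starRingEnd ℂ) (Y i j)).re := by
    intro X Y
    simp [metric, Matrix.trace, Matrix.mul_apply]
  simp only [hexp]
  have hs : HasDerivAt (fun y => ∑ i, ∑ j, V y i j * (starRingEnd ℂ) (W y i j))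
      (∑ i, ∑ j, (matDeriv V x i j * (starRingEnd ℂ) (W x i j)
        + V x i j * (starRingEnd ℂ) (matDeriv W x i j))) x := by
    refine HasDerivAt.fun_sum fun i _ => HasDerivAt.fun_sum fun j _ => ?_
    have hw : HasDerivAt (fun y => (starRingEnd ℂ) (W y i j))
        ((starRingEnd ℂ) (matDeriv W x i j)) x := by
      exact (hW' i j).hasDerivAt.star
    exact (hV' i j).hasDerivAt.mul hw
  have hr := (Complex.reCLM.hasFDerivAt.comp_hasDerivAt x hs).const_mul (1 / 2 : ℝ)
  refine (hr.congr_deriv ?_)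
  simp only [Finset.sum_add_distrib, Complex.reCLM_apply, Complex.add_re]
  ring

theorem deriv_deriv_comm {g : ℝ × ℝ → ℂ} (hgs : ContDiff ℝ ∞ g) (s t : ℝ) :
    deriv (fun s' => deriv (fun t' => g (s', t')) t) s
      = deriv (fun t' => deriv (fun s' => g (s', t')) s) t := by
  have hd : Differentiable ℝ g := hgs.differentiable (by simp)
  have hf : ContDiff ℝ 1 (fderiv ℝ g) := hgs.fderiv_right (by norm_cast)
  have hd2 : Differentiable ℝ (fderiv ℝ g) := hf.differentiable (by simp)
  have c1 : ∀ a b : ℝ, HasDerivAt (fun a' : ℝ => (a', b)) ((1 : ℝ), (0 : ℝ)) a := fun a b =>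
    (hasDerivAt_id a).prodMk (hasDerivAt_const a b)
  have c2 : ∀ a b : ℝ, HasDerivAt (fun b' : ℝ => (a, b')) ((0 : ℝ), (1 : ℝ)) b := fun a b =>
    (hasDerivAt_const b a).prodMk (hasDerivAt_id b)
  have d1 : ∀ a b : ℝ, deriv (fun a' => g (a', b)) a = fderiv ℝ g (a, b) (1, 0) := fun a b =>
    (HasFDerivAt.comp_hasDerivAt (f := fun a' : ℝ => (a', b)) a (hd (a, b)).hasFDerivAt
      (c1 a b)).deriv
  have d2 : ∀ a b : ℝ, deriv (fun b' => g (a, b')) b = fderiv ℝ g (a, b) (0, 1) := fun a b =>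
    (HasFDerivAt.comp_hasDerivAt (f := fun b' : ℝ => (a, b')) b (hd (a, b)).hasFDerivAt
      (c2 a b)).deriv
  simp only [d1, d2]
  have k1 := ((HasFDerivAt.comp_hasDerivAt (f := fun a' : ℝ => (a', t)) s
    (hd2 (s, t)).hasFDerivAt (c1 s t)).clm_apply (hasDerivAt_const s ((0 : ℝ), (1 : ℝ)))).deriv
  have k2 := ((HasFDerivAt.comp_hasDerivAt (f := fun b' : ℝ => (s, b')) t
    (hd2 (s, t)).hasFDerivAt (c2 s t)).clm_apply (hasDerivAt_const t ((1 : ℝ), (0 : ℝ)))).deriv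
  simp only [Function.comp_def, map_zero, add_zero] at k1 k2
  rw [k1, k2]
  have hsym : IsSymmSndFDerivAt ℝ g (s, t) := hgs.contDiffAt.isSymmSndFDerivAt (by simp; norm_cast)
  exact hsym.eq _ _

theorem covDeriv_symm {f : ℝ → ℝ → Mat k m}
    (hf : ∀ i j, ContDiff ℝ ∞ fun p : ℝ × ℝ => f p.1 p.2 i j) (s t : ℝ) :
    covDeriv (fun s' => f s' t) (fun s' => matDeriv (f s') t) s
      = covDeriv (f s) (fun t' => matDeriv (fun s' => f s' t') s) t := by
  rw [covDeriv, covDeriv]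
  congr 1
  ext i j
  simp only [matDeriv, Matrix.of_apply]
  exact deriv_deriv_comm (hf i j) s t

end Facts

end GrassmannFlow

end

/-! ### Integrals from `-∞` and linear equations with integrable coefficient. -/

open MeasureTheory Filter Topology
open scoped BoundedContinuousFunction

/-! Fix `t`, which is only a parameter, and regard `u` as a curve of projectors in `x`. Everything
rests on one linear equation, `E' = E K` with `K = [u, u_x]` and `E → 1` at `-∞`. Since `u_x` is
Schwartz and `u` is bounded, `K` is integrable, so a Volterra argument solves the equation on the
whole line (`exists_hasDerivAt_mul_of_integrable`).

The matrix `K` is skew-Hermitian, so `E E*` is constant and `E` is unitary. For a tangent vector `D`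
at `u` one has `[u, [u, D]] = D`, so `E u E*` is constant too, equal to `A₀`; that is the orbit
condition. Then `E_x E* = E K E*` is the commutator of `A₀` with a Hermitian off-diagonal matrix,
hence lies in `𝔪_I` (`exists_curve_frame`). Conversely every admissible frame solves the same
equation (`matDeriv_frame_eq_mul_comm`), which gives uniqueness.

The parallel frame is the constant frame at `A₀` carried along by `E*`, namely `E* H_j E`. If `E_x =
S E` with `S` in `𝔪_I`, its derivative is `E* [H_j, S] E`. The commutator of two off-diagonal
matrices is block diagonal, so it is normal to the orbit. Uniqueness holds because the difference of
two parallel fields has constant length (`parallel_unique`).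

Finally, if `V` is the upper right block of `P`, then `u_x` is the `E*`-conjugate of the Hermitian
matrix with block `V`. Pairing it with `e_j` and `J e_j` reads off the real and imaginary parts of
the entry `V_j`. -/

theorem hasDerivAt_integral_Iic {F : Type*} [NormedAddCommGroup F] [NormedSpace ℝ F]
    [CompleteSpace F] {f : ℝ → F} (hc : Continuous f) (hi : Integrable f) (x : ℝ) :
    HasDerivAt (fun y => ∫ s in Set.Iic y, f s) (f x) x := by
  have h : (fun y => ∫ s in Set.Iic y, f s)
      = fun y => (∫ s in Set.Iic (0 : ℝ), f s) + ∫ s in (0 : ℝ)..y, f s := by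
    funext y
    rw [← intervalIntegral.integral_Iic_sub_Iic hi.integrableOn hi.integrableOn]
    abel
  rw [h]
  exact (hc.integral_hasStrictDerivAt 0 x).hasDerivAt.const_add _

theorem tendsto_integral_Iic_atBot {F : Type*} [NormedAddCommGroup F] [NormedSpace ℝ F]
    [CompleteSpace F] {f : ℝ → F} (hi : Integrable f) :
    Tendsto (fun y => ∫ s in Set.Iic y, f s) atBot (𝓝 0) := by
  have h : (fun y => ∫ s in Set.Iic y, f s)
      = fun y => (∫ s in Set.Iic (0 : ℝ), f s) - ∫ s in y..(0 : ℝ), f s := by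
    funext y
    rw [← intervalIntegral.integral_Iic_sub_Iic hi.integrableOn hi.integrableOn]
    abel
  rw [h]
  have := (intervalIntegral_tendsto_integral_Iic (μ := volume) (f := f) 0 hi.integrableOn
    tendsto_id).const_sub (∫ s in Set.Iic (0 : ℝ), f s)
  simpa using this

/-- A linear equation `E' = E K` with integrable coefficient has a solution with value `1` at `-∞`:
the Volterra operator is a contraction for a weighted supremum norm. -/
theorem exists_hasDerivAt_mul_of_integrable {R : Type*} [NormedRing R] [NormedAlgebra ℝ R]
    [CompleteSpace R] {K : ℝ → R} (hc : Continuous K) (hi : Integrable fun x => ‖K x‖) :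
    ∃ E : ℝ → R, (∀ x, HasDerivAt E (E x * K x) x) ∧ Tendsto E atBot (𝓝 1) := by
  set φ : ℝ → ℝ := fun x => ∫ s in Set.Iic x, ‖K s‖ with hφ
  have hφd : ∀ x, HasDerivAt φ ‖K x‖ x := hasDerivAt_integral_Iic hc.norm hi
  have hφc : Continuous φ := continuous_iff_continuousAt.2 fun x => (hφd x).continuousAt
  have hφ0 : Tendsto φ atBot (𝓝 0) := tendsto_integral_Iic_atBot hi
  have hφnn : ∀ x, 0 ≤ φ x := fun x => integral_nonneg fun s => norm_nonneg _
  set M : ℝ := ∫ s, ‖K s‖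
  have hφM : ∀ x, φ x ≤ M := fun x =>
    setIntegral_le_integral hi (Eventually.of_forall fun s => norm_nonneg _)
  -- The weight satisfies `v' = 2 v ‖K‖`; the factor 2 is what makes the contraction constant 1/2.
  set v : ℝ → ℝ := fun x => Real.exp (2 * φ x) with hv
  have hvc : Continuous v := by fun_prop
  have hvpos : ∀ x, 0 < v x := fun x => Real.exp_pos _
  have hv1 : ∀ x, 1 ≤ v x := fun x => Real.one_le_exp (by linarith [hφnn x])
  have hvM : ∀ x, v x ≤ Real.exp (2 * M) := fun x => Real.exp_le_exp.2 (by linarith [hφM x])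
  have hvK : Integrable fun s => v s * ‖K s‖ :=
    hi.bdd_mul hvc.aestronglyMeasurable (c := Real.exp (2 * M))
      (Eventually.of_forall fun x => by
        rw [Real.norm_eq_abs, abs_of_pos (hvpos x)]; exact hvM x)
  have hvint : ∀ x, ∫ s in Set.Iic x, v s * ‖K s‖ = (v x - 1) / 2 := by
    intro x
    have hd : ∀ y ∈ Set.Iic x, HasDerivAt (fun y => v y / 2) (v y * ‖K y‖) y := by
      intro y _
      refine ((((hφd y).const_mul 2).exp).div_const 2).congr_deriv ?_
      simp only [hv]; ring
    have ht : Tendsto (fun y => v y / 2) atBot (𝓝 (1 / 2)) := by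
      have := ((Real.continuous_exp.tendsto _).comp (hφ0.const_mul 2)).div_const 2
      simpa [hv, Function.comp_def] using this
    rw [integral_Iic_of_hasDerivAt_of_tendsto' hd hvK.integrableOn ht]
    ring
  have hYc : ∀ Y : ℝ →ᵇ R, Continuous fun s => v s • (Y s * K s) := fun Y =>
    hvc.smul (Y.continuous.mul hc)
  have hYle : ∀ (Y : ℝ →ᵇ R) (s : ℝ), ‖v s • (Y s * K s)‖ ≤ ‖Y‖ * (v s * ‖K s‖) := by
    intro Y s
    rw [norm_smul, Real.norm_eq_abs, abs_of_pos (hvpos s)]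
    calc v s * ‖Y s * K s‖ ≤ v s * (‖Y‖ * ‖K s‖) := by
          gcongr
          exact (norm_mul_le _ _).trans (by gcongr; exact Y.norm_coe_le_norm s)
      _ = _ := by ring
  have hYi : ∀ Y : ℝ →ᵇ R, Integrable fun s => v s • (Y s * K s) := fun Y =>
    (hvK.const_mul ‖Y‖).mono' (hYc Y).aestronglyMeasurable (Eventually.of_forall (hYle Y))
  have hYb : ∀ (Y : ℝ →ᵇ R) (x : ℝ),
      ‖(v x)⁻¹ • ∫ s in Set.Iic x, v s • (Y s * K s)‖ ≤ 1 / 2 * ‖Y‖ := by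
    intro Y x
    have h1 : ‖∫ s in Set.Iic x, v s • (Y s * K s)‖ ≤ ‖Y‖ * ((v x - 1) / 2) := by
      rw [← hvint, ← integral_const_mul]
      exact norm_integral_le_of_norm_le (hvK.const_mul ‖Y‖).integrableOn
        (Eventually.of_forall (hYle Y))
    rw [norm_smul, norm_inv, Real.norm_eq_abs, abs_of_pos (hvpos x),
      inv_mul_le_iff₀ (hvpos x)]
    -- It remains to use `(v - 1) / 2 ≤ v / 2`.
    refine h1.trans ?_
    nlinarith [norm_nonneg Y]
  have hdint : ∀ (Y : ℝ →ᵇ R) (x : ℝ),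
      HasDerivAt (fun y => ∫ s in Set.Iic y, v s • (Y s * K s)) (v x • (Y x * K x)) x :=
    fun Y x => hasDerivAt_integral_Iic (hYc Y) (hYi Y) x
  -- The integral equation `E = 1 + ∫ E K`, written for the bounded unknown `Y = v⁻¹ E`: the plain
  -- supremum norm of `Y` is the weighted norm of `E`.
  let Φ : (ℝ →ᵇ R) → (ℝ →ᵇ R) := fun Y =>
    BoundedContinuousFunction.ofNormedAddCommGroup
      (fun x => (v x)⁻¹ • (1 + ∫ s in Set.Iic x, v s • (Y s * K s)))
      ((hvc.inv₀ fun x => (hvpos x).ne').smul (continuous_const.add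
        (continuous_iff_continuousAt.2 fun x => (hdint Y x).continuousAt)))
      (‖(1 : R)‖ + 1 / 2 * ‖Y‖) (by
        intro x
        rw [smul_add]
        refine (norm_add_le _ _).trans (add_le_add ?_ (hYb Y x))
        rw [norm_smul, norm_inv, Real.norm_eq_abs, abs_of_pos (hvpos x)]
        exact mul_le_of_le_one_left (norm_nonneg _) (inv_le_one_of_one_le₀ (hv1 x)))
  have hΦ : ∀ Y x, Φ Y x = (v x)⁻¹ • (1 + ∫ s in Set.Iic x, v s • (Y s * K s)) :=
    fun _ _ => rfl
  have hcontr : ContractingWith (1 / 2) Φ := by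
    refine ⟨by
      rw [← NNReal.coe_lt_coe]; norm_num, LipschitzWith.of_dist_le_mul fun Y Z => ?_⟩
    rw [BoundedContinuousFunction.dist_le (by positivity)]
    intro x
    have h2 : Φ Y x - Φ Z x = (v x)⁻¹ • ∫ s in Set.Iic x, v s • ((Y - Z) s * K s) := by
      rw [hΦ, hΦ, ← smul_sub, add_sub_add_left_eq_sub,
        ← integral_sub (hYi Y).integrableOn (hYi Z).integrableOn]
      simp [sub_mul, smul_sub]
    rw [dist_eq_norm, h2, dist_eq_norm]
    simpa using hYb (Y - Z) x
  obtain ⟨Y, hY⟩ : ∃ Y, Φ Y = Y := ⟨_, hcontr.fixedPoint_isFixedPt⟩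
  have hE : ∀ x, v x • Y x = 1 + ∫ s in Set.Iic x, v s • (Y s * K s) := by
    intro x
    conv_lhs => rw [← hY, hΦ]
    rw [smul_inv_smul₀ (hvpos x).ne']
  refine ⟨fun x => v x • Y x, fun x => ?_, ?_⟩
  · simp only [hE]
    rw [← hE, smul_mul_assoc]
    exact (hdint Y x).const_add _
  · simp only [hE]
    simpa using (tendsto_integral_Iic_atBot (hYi Y)).const_add (1 : R)

namespace GrassmannFlow

variable {k m : ℕ}

/-! ### The linear equation for matrices. -/

section MatrixODE

-- A submultiplicative norm is needed to apply the result for normed rings; the statement below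
-- involves only entries and the limit.
attribute [local instance] Matrix.linftyOpNormedRing Matrix.linftyOpNormedAlgebra

theorem exists_matrix_solution {K : ℝ → Mat k m} (hc : ∀ i j, Continuous fun x => K x i j)
    (hi : ∀ i j, Integrable fun x => K x i j) :
    ∃ E : ℝ → Mat k m, (∀ x i j, HasDerivAt (fun y => E y i j) ((E x * K x) i j) x) ∧
      Tendsto E atBot (𝓝 1) := by
  have : CompleteSpace (Mat k m) := FiniteDimensional.complete ℝ _
  have hle : ∀ A : Mat k m, ‖A‖ ≤ ∑ i, ∑ j, ‖A i j‖ := by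
    intro A
    have h : (Finset.univ.sup fun i => ∑ j, ‖A i j‖₊) ≤ ∑ i, ∑ j, ‖A i j‖₊ :=
      Finset.sup_le fun i hi => Finset.single_le_sum (f := fun i => ∑ j, ‖A i j‖₊)
        (fun _ _ => zero_le) hi
    rw [Matrix.linfty_opNorm_def]
    simpa only [NNReal.coe_sum, coe_nnnorm] using NNReal.coe_le_coe.2 h
  have hc' : Continuous K := continuous_matrix hc
  have hn : Continuous fun x => ‖K x‖ := continuous_norm.comp hc'
  have hKi : Integrable fun x => ‖K x‖ :=
    (integrable_finsetSum _ fun i _ => integrable_finsetSum _ fun j _ => (hi i j).norm).mono'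
      hn.aestronglyMeasurable (Eventually.of_forall fun x => by
        rw [norm_norm]; exact hle (K x))
  obtain ⟨E, hE, hl⟩ := exists_hasDerivAt_mul_of_integrable hc' hKi
  refine ⟨E, fun x i j => ?_, hl⟩
  exact (LinearMap.toContinuousLinearMap
    (Matrix.entryLinearMap ℝ ℂ i j : Mat k m →ₗ[ℝ] ℂ)).hasFDerivAt.comp_hasDerivAt x (hE x)

end MatrixODE

/-! ### Entrywise calculus for curves of matrices. -/

/-- Differentiability of a curve of matrices, entry by entry. -/
def HasMatDerivAt (F : ℝ → Mat k m) (F' : Mat k m) (x : ℝ) : Prop :=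
  ∀ i j, HasDerivAt (fun y => F y i j) (F' i j) x

theorem HasMatDerivAt.matDeriv_eq {F : ℝ → Mat k m} {F' : Mat k m} {x : ℝ}
    (h : HasMatDerivAt F F' x) : matDeriv F x = F' := by
  ext i j
  exact (h i j).deriv

theorem HasMatDerivAt.mul {F G : ℝ → Mat k m} {F' G' : Mat k m} {x : ℝ}
    (hF : HasMatDerivAt F F' x) (hG : HasMatDerivAt G G' x) :
    HasMatDerivAt (fun y => F y * G y) (F' * G x + F x * G') x := by
  intro i j
  simp only [Matrix.mul_apply, Matrix.add_apply, ← Finset.sum_add_distrib]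
  exact HasDerivAt.fun_sum fun l _ => (hF i l).mul (hG l j)

theorem HasMatDerivAt.conjTranspose {F : ℝ → Mat k m} {F' : Mat k m} {x : ℝ}
    (hF : HasMatDerivAt F F' x) : HasMatDerivAt (fun y => (F y)ᴴ) F'ᴴ x :=
  fun i j => (hF j i).star

theorem hasMatDerivAt_const (A : Mat k m) (x : ℝ) : HasMatDerivAt (fun _ => A) 0 x :=
  fun _ _ => hasDerivAt_const _ _

theorem HasMatDerivAt.congr_deriv {F : ℝ → Mat k m} {F' G' : Mat k m} {x : ℝ}
    (hF : HasMatDerivAt F F' x) (h : F' = G') : HasMatDerivAt F G' x := h ▸ hF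

theorem HasMatDerivAt.sub {F G : ℝ → Mat k m} {F' G' : Mat k m} {x : ℝ}
    (hF : HasMatDerivAt F F' x) (hG : HasMatDerivAt G G' x) :
    HasMatDerivAt (fun y => F y - G y) (F' - G') x :=
  fun i j => (hF i j).sub (hG i j)

theorem SmoothCurve.hasMatDerivAt {F : ℝ → Mat k m} (hF : SmoothCurve F) (x : ℝ) :
    HasMatDerivAt F (matDeriv F x) x :=
  fun i j => ((hF i j).differentiable (by simp) x).hasDerivAt

theorem SmoothCurve.matDeriv {F : ℝ → Mat k m} (hF : SmoothCurve F) :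
    SmoothCurve (matDeriv F) :=
  fun i j => (contDiff_infty_iff_deriv.1 (hF i j)).2

theorem SmoothCurve.mul {F G : ℝ → Mat k m} (hF : SmoothCurve F) (hG : SmoothCurve G) :
    SmoothCurve fun x => F x * G x := by
  intro i j
  simp only [Matrix.mul_apply]
  exact ContDiff.sum fun l _ => (hF i l).mul (hG l j)

theorem SmoothCurve.sub {F G : ℝ → Mat k m} (hF : SmoothCurve F) (hG : SmoothCurve G) :
    SmoothCurve fun x => F x - G x :=
  fun i j => (hF i j).sub (hG i j)

theorem SmoothCurve.conjTranspose {F : ℝ → Mat k m} (hF : SmoothCurve F) :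
    SmoothCurve fun x => (F x)ᴴ :=
  fun i j => Complex.conjCLE.contDiff.comp (hF j i)

theorem smoothCurve_const (A : Mat k m) : SmoothCurve fun _ => A := fun _ _ => contDiff_const

/-- Bootstrapping: if the entries of `E` are of class `C^n`, so are those of `E' = E K`, and `E` is
of class `C^(n+1)`. -/
theorem smoothCurve_of_hasMatDerivAt_mul {E K : ℝ → Mat k m} (hK : SmoothCurve K)
    (hE : ∀ x, HasMatDerivAt E (E x * K x) x) : SmoothCurve E := by
  have h : ∀ n : ℕ, ∀ i j, ContDiff ℝ n fun x => E x i j := by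
    intro n
    induction n with
    | zero =>
      intro i j
      exact contDiff_zero.2 (continuous_iff_continuousAt.2 fun x => (hE x i j).continuousAt)
    | succ n ih =>
      intro i j
      push_cast
      refine contDiff_succ_iff_deriv.2 ⟨fun x => (hE x i j).differentiableAt, by simp, ?_⟩
      have hd : (deriv fun x => E x i j) = fun x => ∑ l, E x i l * K x l j := by
        funext x
        rw [(hE x i j).deriv, Matrix.mul_apply]
      rw [hd]
      exact ContDiff.sum fun l _ => (ih i l).mul ((hK l j).of_le (by exact_mod_cast le_top))
  exact fun i j => contDiff_infty.2 fun n => h n i j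

/-- A conserved quantity is evaluated at `-∞`; this yields unitarity, the orbit condition and
uniqueness of the frame. -/
theorem eq_of_hasMatDerivAt_zero_of_tendsto {F : ℝ → Mat k m} {A : Mat k m}
    (hF : ∀ x, HasMatDerivAt F 0 x) (hl : Tendsto F atBot (𝓝 A)) (x : ℝ) : F x = A := by
  have hc : F = fun _ => F x := by
    funext y
    ext i j
    exact is_const_of_deriv_eq_zero (fun z => (hF z i j).differentiableAt)
      (fun z => (hF z i j).deriv) y x
  rw [hc] at hl
  exact tendsto_nhds_unique tendsto_const_nhds hl

/-! ### Algebra of projectors and tangent vectors. -/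

/-- From `A = A A*`, the real part of `A i i` is the sum of the `‖A i l‖ ^ 2`. Taking `l = i` bounds
the diagonal by 1, and then `l = j` bounds the other entries. It serves to make `[γ, γ']` integrable
when `γ'` is. -/
theorem norm_entry_le_one {A : Mat k m} (hA : A ∈ grassmannian k m) (i j : Fin k ⊕ Fin m) :
    ‖A i j‖ ≤ 1 := by
  obtain ⟨h1, h2, -⟩ := hA
  have h3 : (A i i).re = ∑ l, ‖A i l‖ ^ 2 := by
    have h4 : A i i = ∑ l, ((‖A i l‖ ^ 2 : ℝ) : ℂ) := by
      conv_lhs => rw [← h2]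
      rw [Matrix.mul_apply]
      refine Finset.sum_congr rfl fun l _ => ?_
      rw [← h1.apply l i, Complex.ofReal_pow, ← Complex.mul_conj']
      rfl
    rw [h4, Complex.re_sum]
    exact Finset.sum_congr rfl fun l _ => Complex.ofReal_re _
  have h4 : ∀ l, ‖A i l‖ ^ 2 ≤ (A i i).re := fun l => by
    rw [h3]
    exact Finset.single_le_sum (f := fun l => ‖A i l‖ ^ 2) (fun _ _ => sq_nonneg _)
      (Finset.mem_univ l)
  have h5 := h4 i
  have h6 := h4 j
  have h7 := Complex.re_le_norm (A i i)
  have h8 := norm_nonneg (A i i)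
  have h9 : ‖A i i‖ ≤ 1 := by
    by_contra! h
    nlinarith
  nlinarith [norm_nonneg (A i j)]

theorem psi_eq_iff (A B : Mat k m) : psi A = psi B ↔ A = B := by
  refine ⟨fun h => ?_, fun h => h ▸ rfl⟩
  have := smul_right_injective (Mat k m) Complex.I_ne_zero h
  exact sub_left_injective this

theorem psi_eq_sigma3_conj_iff {A B : Mat k m}
    (hB : B ∈ Matrix.unitaryGroup (Fin k ⊕ Fin m) ℂ) :
    psi A = Bᴴ * sigma3 k m * B ↔ A = Bᴴ * origin k m * B := by
  have h := psi_conj (B := Bᴴ) (Unitary.star_mem hB)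
  rw [Matrix.conjTranspose_conjTranspose] at h
  rw [← h, psi_eq_iff]

theorem origin_mul_hermBlock_sub (V : Matrix (Fin k) (Fin m) ℂ) :
    origin k m * hermBlock V - hermBlock V * origin k m = skewBlock V := by
  simp [origin, hermBlock, skewBlock, Matrix.fromBlocks_multiply, sub_eq_add_neg,
    Matrix.fromBlocks_neg, Matrix.fromBlocks_add]

theorem origin_mul_skewBlock_sub (V : Matrix (Fin k) (Fin m) ℂ) :
    origin k m * skewBlock V - skewBlock V * origin k m = hermBlock V := by
  simp [origin, hermBlock, skewBlock, Matrix.fromBlocks_multiply, sub_eq_add_neg,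
    Matrix.fromBlocks_neg, Matrix.fromBlocks_add]

theorem conjTranspose_skewBlock (V : Matrix (Fin k) (Fin m) ℂ) :
    (skewBlock V)ᴴ = -skewBlock V := by
  simp [skewBlock, Matrix.fromBlocks_conjTranspose, Matrix.fromBlocks_neg]

/-- Differentiate `γ* = γ` and `γ γ = γ`. -/
theorem matDeriv_mem_tangentSpace {γ : ℝ → Mat k m} (hγ : SmoothCurve γ)
    (hmem : ∀ x, γ x ∈ grassmannian k m) (x : ℝ) : matDeriv γ x ∈ tangentSpace (γ x) := by
  have hd := hγ.hasMatDerivAt x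
  refine ⟨?_, ?_⟩
  · have h := hd.conjTranspose.matDeriv_eq
    simp only [(hmem _).1.eq] at h
    exact h.symm
  · have h := (hd.mul hd).matDeriv_eq
    simp only [(hmem _).2.1] at h
    exact h.symm

theorem conj_mul_conj {B X Y : Mat k m} (hB : B ∈ Matrix.unitaryGroup (Fin k ⊕ Fin m) ℂ) :
    (Bᴴ * X * B) * (Bᴴ * Y * B) = Bᴴ * (X * Y) * B := by
  have h : B * Bᴴ = 1 := Matrix.mem_unitaryGroup_iff.1 hB
  calc (Bᴴ * X * B) * (Bᴴ * Y * B) = Bᴴ * X * (B * Bᴴ) * Y * B := by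
        simp only [Matrix.mul_assoc]
    _ = _ := by rw [h]; simp only [Matrix.mul_one, Matrix.mul_assoc]

theorem conjTranspose_comm_deriv {γ D : Mat k m} (hγ : γ ∈ grassmannian k m)
    (hD : D ∈ tangentSpace γ) : (γ * D - D * γ)ᴴ = -(γ * D - D * γ) := by
  simp [Matrix.conjTranspose_mul, hγ.1.eq, hD.1.eq]

theorem mul_tangent_mul {γ D : Mat k m} (hγ : γ ∈ grassmannian k m)
    (hD : D ∈ tangentSpace γ) : γ * D * γ = 0 := by
  have h4 : γ * (D * γ + γ * D) = γ * D := by rw [hD.2]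
  rw [mul_add, ← mul_assoc, ← mul_assoc, hγ.2.1] at h4
  simpa using h4

theorem tendsto_mul_conjTranspose {E F : ℝ → Mat k m} {A B : Mat k m}
    (hE : Tendsto E atBot (𝓝 A)) (hF : Tendsto F atBot (𝓝 B)) :
    Tendsto (fun x => E x * (F x)ᴴ) atBot (𝓝 (A * Bᴴ)) :=
  hE.mul ((continuous_id.matrix_conjTranspose.tendsto B).comp hF)

/-! ### The unitary frame of a single curve. -/

theorem exists_curve_frame {γ : ℝ → Mat k m} (hγ : SmoothCurve γ)
    (hmem : ∀ x, γ x ∈ grassmannian k m) (hl : Tendsto γ atBot (𝓝 (origin k m)))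
    (hi : ∀ i j, Integrable fun x => matDeriv γ x i j) :
    ∃ E : ℝ → Mat k m, SmoothCurve E ∧
      (∀ x, E x ∈ Matrix.unitaryGroup (Fin k ⊕ Fin m) ℂ) ∧
      (∀ x, γ x = (E x)ᴴ * origin k m * E x) ∧ Tendsto E atBot (𝓝 1) ∧
      ∀ x, matDeriv E x * (E x)ᴴ ∈ mI k m := by
  set D := matDeriv γ with hD
  have hDs : SmoothCurve D := hγ.matDeriv
  have hDt : ∀ x, D x ∈ tangentSpace (γ x) := matDeriv_mem_tangentSpace hγ hmem
  set K : ℝ → Mat k m := fun x => γ x * D x - D x * γ x with hK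
  have hKs : SmoothCurve K := (hγ.mul hDs).sub (hDs.mul hγ)
  have hγb : ∀ i j, Integrable fun x => K x i j := by
    intro i j
    simp only [hK, Matrix.sub_apply, Matrix.mul_apply]
    refine (integrable_finsetSum _ fun l _ => ?_).sub (integrable_finsetSum _ fun l _ => ?_)
    · exact (hi l j).bdd_mul (hγ i l).continuous.aestronglyMeasurable
        (Eventually.of_forall fun x => norm_entry_le_one (hmem x) i l)
    · exact (hi i l).mul_bdd (hγ l j).continuous.aestronglyMeasurable
        (Eventually.of_forall fun x => norm_entry_le_one (hmem x) l j)
  have hKH : ∀ x, (K x)ᴴ = -K x := fun x => conjTranspose_comm_deriv (hmem x) (hDt x)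
  obtain ⟨E, hE, hEl⟩ := exists_matrix_solution (fun i j => (hKs i j).continuous) hγb
  replace hE : ∀ x, HasMatDerivAt E (E x * K x) x := hE
  have hEU : ∀ x, E x * (E x)ᴴ = 1 := by
    refine eq_of_hasMatDerivAt_zero_of_tendsto (fun x => ?_)
      (by simpa using tendsto_mul_conjTranspose hEl hEl)
    refine ((hE x).mul (hE x).conjTranspose).congr_deriv ?_
    rw [Matrix.conjTranspose_mul, hKH]
    noncomm_ring
  have hEγ : ∀ x, E x * γ x * (E x)ᴴ = origin k m := by
    refine eq_of_hasMatDerivAt_zero_of_tendsto (fun x => ?_)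
      (by simpa using tendsto_mul_conjTranspose (hEl.mul hl) hEl)
    refine (((hE x).mul (hγ.hasMatDerivAt x)).mul (hE x).conjTranspose).congr_deriv ?_
    rw [Matrix.conjTranspose_mul, hKH]
    -- This is `[γ, [γ, D]] = D`, a consequence of `γ² = γ`, `γ D γ = 0` and `D γ + γ D = D`.
    have h1 : K x * γ x + D x - γ x * K x = 0 := by
      have h2 : K x * γ x + D x - γ x * K x = γ x * D x * γ x + γ x * D x * γ x
          + D x - D x * (γ x * γ x) - γ x * γ x * D x := by
        simp only [hK]; noncomm_ring
      rw [h2, mul_tangent_mul (hmem x) (hDt x), (hmem x).2.1]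
      conv_lhs => enter [1, 1, 2]; rw [← (hDt x).2]
      abel
    calc _ = E x * (K x * γ x + D x - γ x * K x) * (E x)ᴴ := by
          simp only [← hD]; noncomm_ring
      _ = 0 := by rw [h1]; simp
  have hU : ∀ x, E x ∈ Matrix.unitaryGroup (Fin k ⊕ Fin m) ℂ := fun x =>
    Matrix.mem_unitaryGroup_iff.2 (hEU x)
  have hU' : ∀ x, (E x)ᴴ * E x = 1 := fun x => Matrix.mem_unitaryGroup_iff'.1 (hU x)
  have horb : ∀ x, γ x = (E x)ᴴ * origin k m * E x := by
    intro x
    calc γ x = ((E x)ᴴ * E x) * γ x * ((E x)ᴴ * E x) := by rw [hU']; simp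
      _ = (E x)ᴴ * (E x * γ x * (E x)ᴴ) * E x := by simp only [Matrix.mul_assoc]
      _ = _ := by rw [hEγ]
  refine ⟨E, smoothCurve_of_hasMatDerivAt_mul hKs hE, hU, horb, hEl, fun x => ?_⟩
  rw [(hE x).matDeriv_eq]
  have hx := hDt x
  -- The block description applies with `B = E*`, since `γ = E* A₀ E`.
  have hB := mem_tangentSpace_iff (Unitary.star_mem (hU x)) (D x)
  rw [Matrix.star_eq_conjTranspose, Matrix.conjTranspose_conjTranspose, ← horb] at hB
  obtain ⟨V, hV⟩ := hB.1 hx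
  refine ⟨V, ?_⟩
  have h3 : K x = (E x)ᴴ * skewBlock V * E x := by
    rw [← origin_mul_hermBlock_sub]
    simp only [hK]
    rw [horb x, hV, conj_mul_conj (hU x), conj_mul_conj (hU x)]
    noncomm_ring
  calc E x * K x * (E x)ᴴ = (E x * (E x)ᴴ) * skewBlock V * (E x * (E x)ᴴ) := by
        rw [h3]; simp only [Matrix.mul_assoc]
    _ = _ := by rw [hEU]; simp

theorem matDeriv_frame_eq {E : ℝ → Mat k m}
    (hU : ∀ x, E x ∈ Matrix.unitaryGroup (Fin k ⊕ Fin m) ℂ) {x : ℝ}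
    {V : Matrix (Fin k) (Fin m) ℂ} (hV : matDeriv E x * (E x)ᴴ = skewBlock V) :
    matDeriv E x = skewBlock V * E x := by
  have h : (E x)ᴴ * E x = 1 := Matrix.mem_unitaryGroup_iff'.1 (hU x)
  rw [← hV, Matrix.mul_assoc, h, Matrix.mul_one]

theorem hasMatDerivAt_conj_frame {E : ℝ → Mat k m} (hE : SmoothCurve E)
    (hU : ∀ x, E x ∈ Matrix.unitaryGroup (Fin k ⊕ Fin m) ℂ) {x : ℝ}
    {V : Matrix (Fin k) (Fin m) ℂ} (hV : matDeriv E x * (E x)ᴴ = skewBlock V) (A : Mat k m) :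
    HasMatDerivAt (fun y => (E y)ᴴ * A * E y)
      ((E x)ᴴ * (A * skewBlock V - skewBlock V * A) * E x) x := by
  have hd := hE.hasMatDerivAt x
  refine ((hd.conjTranspose.mul (hasMatDerivAt_const A x)).mul hd).congr_deriv ?_
  rw [matDeriv_frame_eq hU hV, Matrix.conjTranspose_mul, conjTranspose_skewBlock]
  noncomm_ring

theorem matDeriv_curve_eq {γ E : ℝ → Mat k m} (hE : SmoothCurve E)
    (hU : ∀ x, E x ∈ Matrix.unitaryGroup (Fin k ⊕ Fin m) ℂ)
    (horb : ∀ x, γ x = (E x)ᴴ * origin k m * E x) {x : ℝ}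
    {V : Matrix (Fin k) (Fin m) ℂ} (hV : matDeriv E x * (E x)ᴴ = skewBlock V) :
    matDeriv γ x = (E x)ᴴ * hermBlock V * E x := by
  rw [funext horb, (hasMatDerivAt_conj_frame hE hU hV _).matDeriv_eq, origin_mul_skewBlock_sub]

/-- Conjugating `[A₀, H] = S` by `E` turns `E' = S E` into an equation whose coefficient depends on
`γ` alone, so any two frames of `γ` solve the same linear equation. -/
theorem matDeriv_frame_eq_mul_comm {γ E : ℝ → Mat k m} (hE : SmoothCurve E)
    (hU : ∀ x, E x ∈ Matrix.unitaryGroup (Fin k ⊕ Fin m) ℂ)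
    (horb : ∀ x, γ x = (E x)ᴴ * origin k m * E x) {x : ℝ}
    (hV : matDeriv E x * (E x)ᴴ ∈ mI k m) :
    matDeriv E x = E x * (γ x * matDeriv γ x - matDeriv γ x * γ x) := by
  obtain ⟨V, hV⟩ := hV
  have h : E x * (E x)ᴴ = 1 := Matrix.mem_unitaryGroup_iff.1 (hU x)
  rw [matDeriv_curve_eq hE hU horb hV, horb x, conj_mul_conj (hU x), conj_mul_conj (hU x),
    matDeriv_frame_eq hU hV, ← origin_mul_hermBlock_sub]
  calc _ = (E x * (E x)ᴴ) * (origin k m * hermBlock V - hermBlock V * origin k m) * E x := by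
        rw [h, Matrix.one_mul]
    _ = _ := by noncomm_ring

/-! ### Parallel fields and conjugation by the frame. -/

open scoped ComplexOrder in
theorem metric_eq_zero {X : Mat k m} (h : metric X X = 0) : X = 0 := by
  have h1 : 0 ≤ Matrix.trace (X * Xᴴ) := (Matrix.posSemidef_self_mul_conjTranspose X).trace_nonneg
  refine Matrix.trace_mul_conjTranspose_self_eq_zero_iff.1 ?_
  rw [metric] at h
  refine Complex.ext ?_ (Complex.nonneg_iff.1 h1).2.symm
  simpa using h

theorem continuous_metric_self : Continuous fun X : Mat k m => metric X X := by
  unfold metric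
  exact continuous_const.mul (Complex.continuous_re.comp
    (continuous_id.matrix_mul continuous_id.matrix_conjTranspose).matrix_trace)

theorem tangentSpace_sub {A X Y : Mat k m} (hX : X ∈ tangentSpace A) (hY : Y ∈ tangentSpace A) :
    X - Y ∈ tangentSpace A := by
  refine ⟨hX.1.sub hY.1, ?_⟩
  calc (X - Y) * A + A * (X - Y) = (X * A + A * X) - (Y * A + A * Y) := by noncomm_ring
    _ = X - Y := by rw [hX.2, hY.2]

/-- The difference is parallel, so metric compatibility makes its squared length constant; the
length tends to 0 at `-∞`, and the metric is definite. -/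
theorem parallel_unique {γ e f : ℝ → Mat k m} {A : Mat k m}
    (hmem : ∀ x, γ x ∈ grassmannian k m) (he : SmoothCurve e) (hf : SmoothCurve f)
    (het : ∀ x, e x ∈ tangentSpace (γ x)) (hft : ∀ x, f x ∈ tangentSpace (γ x))
    (hep : ∀ x, covDeriv γ e x = 0) (hfp : ∀ x, covDeriv γ f x = 0)
    (hel : Tendsto e atBot (𝓝 A)) (hfl : Tendsto f atBot (𝓝 A)) : e = f := by
  have hds : SmoothCurve fun x => e x - f x := he.sub hf
  have hdt : ∀ x, e x - f x ∈ tangentSpace (γ x) := fun x => tangentSpace_sub (het x) (hft x)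
  have hdp : ∀ x, covDeriv γ (fun x => e x - f x) x = 0 := by
    intro x
    rw [covDeriv, ((he.hasMatDerivAt x).sub (hf.hasMatDerivAt x)).matDeriv_eq]
    calc _ = covDeriv γ e x - covDeriv γ f x := by
          simp only [covDeriv, tangentProj]; noncomm_ring
      _ = 0 := by rw [hep, hfp, sub_zero]
  have hdd : ∀ x i j, DifferentiableAt ℝ (fun y => (e y - f y) i j) x := fun x i j =>
    (hds i j).differentiable (by simp) x
  have hm : ∀ x, HasDerivAt (fun y => metric (e y - f y) (e y - f y)) 0 x := by
    intro x
    refine (hasDerivAt_metric (hmem x) hdt hdt (hdd x) (hdd x)).congr_deriv ?_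
    rw [hdp]
    simp [metric]
  have hlim : Tendsto (fun y => metric (e y - f y) (e y - f y)) atBot (𝓝 0) := by
    have h0 : metric (A - A) (A - A) = 0 := by simp [metric]
    rw [← h0]
    exact (continuous_metric_self.tendsto _).comp (hel.sub hfl)
  funext x
  refine sub_eq_zero.1 (metric_eq_zero ?_)
  have hc : (fun y => metric (e y - f y) (e y - f y)) = fun _ => metric (e x - f x) (e x - f x) :=
    funext fun y => is_const_of_deriv_eq_zero (fun z => (hm z).differentiableAt)
      (fun z => (hm z).deriv) y x
  rw [hc] at hlim
  exact tendsto_nhds_unique tendsto_const_nhds hlim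

theorem tangentProj_conj {B A X : Mat k m} (hB : B ∈ Matrix.unitaryGroup (Fin k ⊕ Fin m) ℂ) :
    tangentProj (Bᴴ * A * B) (Bᴴ * X * B) = Bᴴ * tangentProj A X * B := by
  have h : (1 : Mat k m) - Bᴴ * A * B = Bᴴ * (1 - A) * B := by
    have h2 : Bᴴ * B = 1 := Matrix.mem_unitaryGroup_iff'.1 hB
    rw [mul_sub, sub_mul, mul_one, h2]
  rw [tangentProj, tangentProj, h, conj_mul_conj hB, conj_mul_conj hB, conj_mul_conj hB,
    conj_mul_conj hB, mul_add, add_mul]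

/-- The commutator is block diagonal, while the projection at `A₀` keeps only the off-diagonal
blocks. -/
theorem tangentProj_origin_comm (V W : Matrix (Fin k) (Fin m) ℂ) :
    tangentProj (origin k m) (hermBlock W * skewBlock V - skewBlock V * hermBlock W) = 0 := by
  have h : (1 : Mat k m) - origin k m = Matrix.fromBlocks 0 0 0 1 := by
    rw [origin, ← Matrix.fromBlocks_one, sub_eq_add_neg, Matrix.fromBlocks_neg,
      Matrix.fromBlocks_add]
    simp
  rw [tangentProj, h]
  simp [origin, hermBlock, skewBlock, Matrix.fromBlocks_multiply, sub_eq_add_neg,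
    Matrix.fromBlocks_neg, Matrix.fromBlocks_add]

theorem mem_tangentSpace_conj {B : Mat k m} (hB : B ∈ Matrix.unitaryGroup (Fin k ⊕ Fin m) ℂ)
    (V : Matrix (Fin k) (Fin m) ℂ) :
    Bᴴ * hermBlock V * B ∈ tangentSpace (Bᴴ * origin k m * B) := by
  have h := (mem_tangentSpace_iff (Unitary.star_mem hB) _).2 ⟨V, rfl⟩
  simpa [Matrix.star_eq_conjTranspose] using h

theorem metric_conj' {B : Mat k m} (hB : B ∈ Matrix.unitaryGroup (Fin k ⊕ Fin m) ℂ)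
    (V W : Matrix (Fin k) (Fin m) ℂ) :
    metric (Bᴴ * hermBlock V * B) (Bᴴ * hermBlock W * B) = (Matrix.trace (V * Wᴴ)).re := by
  have h := metric_conj (Unitary.star_mem hB) V W
  simpa [Matrix.star_eq_conjTranspose] using h

theorem complexStructure_conj' {B : Mat k m}
    (hB : B ∈ Matrix.unitaryGroup (Fin k ⊕ Fin m) ℂ) (V : Matrix (Fin k) (Fin m) ℂ) :
    complexStructure (Bᴴ * origin k m * B) (Bᴴ * hermBlock V * B)
      = Bᴴ * hermBlock (Complex.I • V) * B := by
  have h := complexStructure_conj (Unitary.star_mem hB) V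
  simpa [Matrix.star_eq_conjTranspose] using h

theorem trace_mul_conjTranspose_single (V : Matrix (Fin k) (Fin m) ℂ) (j : Fin k × Fin m)
    (c : ℂ) : Matrix.trace (V * (Matrix.single j.1 j.2 c)ᴴ) = V j.1 j.2 * star c := by
  rw [Matrix.conjTranspose_single, Matrix.trace_mul_single, op_smul_eq_mul]

theorem MemC.smoothCurve {T : EReal} {a : Mat k m} {u : ℝ → ℝ → Mat k m} (hu : MemC T a u)
    {t : ℝ} (ht : t ∈ timeInterval T) : SmoothCurve (u t) := fun i j =>
  (hu.smooth i j).comp_contDiff (f := fun x : ℝ => (t, x)) (contDiff_const.prodMk contDiff_id)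
    fun x => ⟨ht, Set.mem_univ x⟩

/-- The Schwartz hypothesis enters the argument only through this integrability. -/
theorem MemC.integrable {T : EReal} {a : Mat k m} {u : ℝ → ℝ → Mat k m} (hu : MemC T a u)
    {t : ℝ} (ht : t ∈ timeInterval T) (i j : Fin k ⊕ Fin m) :
    Integrable fun x => matDeriv (u t) x i j := by
  obtain ⟨f, hf⟩ := hu.schwartz t ht i j
  rw [← funext hf]
  exact f.integrable

/-! ### The two frames along `u` and the components of `u_x`. -/

section Frames

variable {T : EReal} {u : ℝ → ℝ → Mat k m}

theorem exists_isOrbitFrame (hu : MemC T (origin k m) u) :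
    ∃ E : timeInterval T → ℝ → Mat k m, IsOrbitFrame u E := by
  choose E h using fun t : timeInterval T => exists_curve_frame (hu.smoothCurve t.2)
    (hu.mem t t.2) (hu.lim t t.2) (hu.integrable t.2)
  exact ⟨E, fun t => (h t).1, fun t => (h t).2.1,
    fun t x => (psi_eq_sigma3_conj_iff ((h t).2.1 x)).2 ((h t).2.2.1 x),
    fun t => (h t).2.2.2.1, fun t => (h t).2.2.2.2⟩

theorem IsOrbitFrame.eq_conj {E : timeInterval T → ℝ → Mat k m} (hE : IsOrbitFrame u E)
    (t : timeInterval T) (x : ℝ) : u t x = (E t x)ᴴ * origin k m * E t x :=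
  (psi_eq_sigma3_conj_iff (hE.unitary t x)).1 (hE.orbit t x)

theorem IsOrbitFrame.unique (hu : MemC T (origin k m) u) {E F : timeInterval T → ℝ → Mat k m}
    (hE : IsOrbitFrame u E) (hF : IsOrbitFrame u F) : E = F := by
  funext t x
  have h1 : ∀ y, E t y * (F t y)ᴴ = 1 := by
    refine eq_of_hasMatDerivAt_zero_of_tendsto (fun y => ?_)
      (by simpa using tendsto_mul_conjTranspose (hE.lim t) (hF.lim t))
    refine (((hE.smooth t).hasMatDerivAt y).mul
      ((hF.smooth t).hasMatDerivAt y).conjTranspose).congr_deriv ?_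
    rw [matDeriv_frame_eq_mul_comm (hE.smooth t) (hE.unitary t) (hE.eq_conj t)
        (hE.logDeriv_mem t y),
      matDeriv_frame_eq_mul_comm (hF.smooth t) (hF.unitary t) (hF.eq_conj t)
        (hF.logDeriv_mem t y), Matrix.conjTranspose_mul,
      conjTranspose_comm_deriv (hu.mem t t.2 y)
        (matDeriv_mem_tangentSpace (hu.smoothCurve t.2) (hu.mem t t.2) y)]
    noncomm_ring
  have h2 : (F t x)ᴴ * F t x = 1 := Matrix.mem_unitaryGroup_iff'.1 (hF.unitary t x)
  calc E t x = E t x * ((F t x)ᴴ * F t x) := by rw [h2, Matrix.mul_one]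
    _ = F t x := by rw [← Matrix.mul_assoc, h1, Matrix.one_mul]

theorem IsOrbitFrame.isParallelFrame {E : timeInterval T → ℝ → Mat k m}
    (hE : IsOrbitFrame u E) : IsParallelFrame u fun t j x =>
      (E t x)ᴴ * hermBlock (Matrix.single j.1 j.2 1) * E t x where
  smooth t _ := (((hE.smooth t).conjTranspose).mul (smoothCurve_const _)).mul (hE.smooth t)
  tangent t j x := by
    rw [hE.eq_conj]
    exact mem_tangentSpace_conj (hE.unitary t x) _
  parallel t j x := by
    obtain ⟨V, hV⟩ := hE.logDeriv_mem t x
    rw [covDeriv, (hasMatDerivAt_conj_frame (hE.smooth t) (hE.unitary t) hV _).matDeriv_eq,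
      hE.eq_conj, tangentProj_conj (hE.unitary t x), tangentProj_origin_comm]
    simp
  lim t j := by
    have h := ((continuous_id.matrix_conjTranspose.tendsto (1 : Mat k m)).comp (hE.lim t)).mul
      (tendsto_const_nhds (x := hermBlock (Matrix.single j.1 j.2 (1 : ℂ)))) |>.mul (hE.lim t)
    simpa using h

theorem IsParallelFrame.unique (hu : MemC T (origin k m) u)
    {e f : timeInterval T → Fin k × Fin m → ℝ → Mat k m}
    (he : IsParallelFrame u e) (hf : IsParallelFrame u f) : e = f := by
  funext t j
  exact parallel_unique (hu.mem t t.2) (he.smooth t j) (hf.smooth t j) (he.tangent t j)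
    (hf.tangent t j) (he.parallel t j) (hf.parallel t j) (he.lim t j) (hf.lim t j)

theorem IsOrbitFrame.isOrthonormalFrame {E : timeInterval T → ℝ → Mat k m}
    (hE : IsOrbitFrame u E) : IsOrthonormalFrame u fun t j x =>
      (E t x)ᴴ * hermBlock (Matrix.single j.1 j.2 1) * E t x := by
  intro t x j l
  have hU := hE.unitary t x
  have hjl : (j.1 = l.1 ∧ j.2 = l.2) ↔ j = l := Prod.ext_iff.symm
  simp only [hE.eq_conj, complexStructure_conj' hU, metric_conj' hU, Matrix.smul_single,
    trace_mul_conjTranspose_single, Matrix.single_apply, hjl]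
  by_cases h : j = l <;> simp [h]

theorem IsOrbitFrame.logDeriv_eq {E : timeInterval T → ℝ → Mat k m} (hE : IsOrbitFrame u E)
    (t : timeInterval T) (x : ℝ) :
    logDeriv E t x = skewBlock (components u (fun t j x =>
      (E t x)ᴴ * hermBlock (Matrix.single j.1 j.2 1) * E t x) t x) := by
  obtain ⟨V, hV⟩ := hE.logDeriv_mem t x
  have hU := hE.unitary t x
  rw [hV]
  congr 1
  ext a b
  have hd := matDeriv_curve_eq (hE.smooth t) (hE.unitary t) (hE.eq_conj t) hV
  have hs := fun c : ℂ => trace_mul_conjTranspose_single V (a, b) c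
  simp only at hs
  simp only [components, Matrix.of_apply, hd, hE.eq_conj, complexStructure_conj' hU,
    metric_conj' hU, Matrix.smul_single, hs]
  -- The pairings have become `Re (V a b)` and, with `c = √-1`, `Re (-√-1 V a b) = Im (V a b)`.
  apply Complex.ext <;> simp

end Frames

end GrassmannFlow

theorem mainTheorem3 (n₀ k₀ : ℕ) (hk : 1 ≤ k₀) (hkn : k₀ < n₀) (T : EReal) (hT : 0 < T)
    (u : ℝ → ℝ → GrassmannFlow.Mat k₀ (n₀ - k₀))
    (hu : GrassmannFlow.MemC T (GrassmannFlow.origin k₀ (n₀ - k₀)) u) :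
    (∃! E : GrassmannFlow.timeInterval T → ℝ → GrassmannFlow.Mat k₀ (n₀ - k₀),
      GrassmannFlow.IsOrbitFrame u E) ∧
    (∃! e : GrassmannFlow.timeInterval T → Fin k₀ × Fin (n₀ - k₀) → ℝ →
        GrassmannFlow.Mat k₀ (n₀ - k₀),
      GrassmannFlow.IsParallelFrame u e) ∧
    ∀ (E : GrassmannFlow.timeInterval T → ℝ → GrassmannFlow.Mat k₀ (n₀ - k₀))
      (e : GrassmannFlow.timeInterval T → Fin k₀ × Fin (n₀ - k₀) → ℝ →
        GrassmannFlow.Mat k₀ (n₀ - k₀)),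
      GrassmannFlow.IsOrbitFrame u E → GrassmannFlow.IsParallelFrame u e →
        GrassmannFlow.IsOrthonormalFrame u e ∧
        ∀ (t : GrassmannFlow.timeInterval T) (x : ℝ),
          GrassmannFlow.logDeriv E t x =
            Matrix.fromBlocks 0 (GrassmannFlow.components u e t x)
              (-(GrassmannFlow.components u e t x)ᴴ) 0 := by
  refine ⟨?_, ?_, fun E e hE he => ?_⟩
  · obtain ⟨E, hE⟩ := GrassmannFlow.exists_isOrbitFrame hu
    exact ⟨E, hE, fun F hF => hF.unique hu hE⟩
  · obtain ⟨E, hE⟩ := GrassmannFlow.exists_isOrbitFrame hu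
    exact ⟨_, hE.isParallelFrame, fun f hf => hf.unique hu hE.isParallelFrame⟩
  · obtain rfl := he.unique hu hE.isParallelFrame
    exact ⟨hE.isOrthonormalFrame, fun t x => hE.logDeriv_eq t x⟩
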